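/- Let $n\ge 2$ and let $\mathcal O_n$ be the Cuntz algebra, i.e. the universal $C^*$-algebra generated by $n$ isometries $S_1,\dots,S_n$ with $\sum_{i=1}^n S_iS_i^*=1$. For a word $\mu=(\mu_1,\dots,\mu_k)$ in $\{1,\dots,n\}$ write $S_\mu=S_{\mu_1}\cdots S_{\mu_k}$. Let $\mathcal D_n^k=\mathrm{span}\{S_\mu S_\mu^* : |\mu|=k\}$, let the diagonal $\mathcal D_n$ be the norm closure of $\bigcup_k\mathcal D_n^k$, and let $\varphi(x)=\sum_{i=1}^n S_ixS_i^*$ be the canonical endomorphism of $\mathcal O_n$. A permutation automorphism of $\mathcal O_n$ is an automorphism $\theta$ for which there are $k\ge 0$ and a permutation $\pi$ of the words of length $k$ such that $\theta(S_i)=wS_i$ for all $i$, where $w=\sum_{|\mu|=k}S_{\pi(\mu)}S_\mu^*$. Let $\alpha$ be a product-type automorphism of $\mathcal D_n$, i.e. a $*$-automorphism with $\alpha(\varphi^k(\mathcal D_n^1))=\varphi^k(\mathcal D_n^1)$ for all $k\ge 0$. Then $\alpha$ extends to a (possibly proper) unital $*$-endomorphism of $\mathcal O_n$ if and only if its actions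 on the algebras $\varphi^k(\mathcal D_n^1)$ are eventually identical to one another, i.e. there are $K\ge 0$ and an automorphism $\beta$ of $\mathcal D_n^1$ such that $\alpha(\varphi^k(x))=\varphi^k(\beta(x))$ for all $k\ge K$ and all $x\in\mathcal D_n^1$. In that case $\alpha$ extends to a permutation automorphism of $\mathcal O_n$. Consequently, for every $n\ge 2$ there is a (product-type) automorphism of $\mathcal D_n$ that extends to no endomorphism of $\mathcal O_n$. -/

import Mathlib

open Filter
open scoped ENNReal

noncomputable section

namespace Cuntz

/-- The separable infinite-dimensional complex Hilbert space. -/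
abbrev H : Type := lp (fun _ : ℕ => ℂ) 2

instance : Nontrivial H :=
  ⟨⟨lp.single 2 0 (1 : ℂ), 0, fun h => by
    have := congrArg (fun f : H => (f : ℕ → ℂ) 0) h
    simp at this⟩⟩

/-- A Cuntz family of size `n` on `H`: `n` isometries whose range projections sum up to `1`. -/
structure Family (n : ℕ) where
  T : Fin n → (H →L[ℂ] H)
  isometry : ∀ i, star (T i) * T i = 1
  sum_range : ∑ i, T i * star (T i) = 1

/-- The C⋆-algebra of all norm-bounded choices of an operator on `H` for every Cuntz family,
with pointwise operations and the supremum norm. -/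
def Ambient (n : ℕ) : Type := lp (fun _ : Family n => H →L[ℂ] H) ∞

def ambientCStarAlgebra (n : ℕ) : CStarAlgebra (Ambient n) :=
  { (inferInstance : NormedRing (lp (fun _ : Family n => H →L[ℂ] H) ∞)),
    (inferInstance : StarRing (lp (fun _ : Family n => H →L[ℂ] H) ∞)),
    (inferInstance : NormedAlgebra ℂ (lp (fun _ : Family n => H →L[ℂ] H) ∞)),
    (inferInstance : CompleteSpace (lp (fun _ : Family n => H →L[ℂ] H) ∞)),
    (inferInstance : CStarRing (lp (fun _ : Family n => H →L[ℂ] H) ∞)),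
    (inferInstance : StarModule ℂ (lp (fun _ : Family n => H →L[ℂ] H) ∞)) with }

instance (n : ℕ) : CStarAlgebra (Ambient n) := ambientCStarAlgebra n

theorem Family.norm_le_one {n : ℕ} (F : Family n) (i : Fin n) : ‖F.T i‖ ≤ 1 := by
  have h : ‖F.T i‖ * ‖F.T i‖ = ‖(1 : H →L[ℂ] H)‖ := by
    rw [← CStarRing.norm_star_mul_self, F.isometry]
  have h1 : ‖(1 : H →L[ℂ] H)‖ ≤ 1 := ContinuousLinearMap.norm_id_le
  nlinarith [norm_nonneg (F.T i)]

/-- The tuple of the `i`-th isometries of all Cuntz families. -/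
def universalGen (n : ℕ) (i : Fin n) : Ambient n :=
  ⟨fun F => F.T i, memℓp_infty ⟨1, by rintro _ ⟨F, rfl⟩; exact F.norm_le_one i⟩⟩

/-- The universal C⋆-algebra generated by `n` isometries whose ranges sum up to `1`: the
completion of the ⋆-polynomials in the generators for the norm `sup ‖p(T)‖`, the supremum being
over all Cuntz families `T` on the separable Hilbert space `H`. (A C⋆-algebra generated by a
Cuntz family is separable, so representations on `H` suffice, by Gelfand–Naimark.) -/
def algebra (n : ℕ) : StarSubalgebra ℂ (Ambient n) :=
  (StarAlgebra.adjoin ℂ (Set.range (universalGen n))).topologicalClosure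

/-- The Cuntz algebra `𝒪_n`. -/
abbrev O (n : ℕ) : Type := algebra n

instance (n : ℕ) : CStarAlgebra (O n) :=
  haveI : IsClosed (algebra n : Set (Ambient n)) := StarSubalgebra.isClosed_topologicalClosure _
  StarSubalgebra.cstarAlgebra (algebra n)

/-- The canonical generating isometries `S_1, …, S_n` of `𝒪_n`. -/
def S {n : ℕ} (i : Fin n) : O n :=
  ⟨universalGen n i, StarSubalgebra.le_topologicalClosure _
    (StarAlgebra.subset_adjoin ℂ _ ⟨i, rfl⟩)⟩

/-- `S_μ = S_{μ_1} ⋯ S_{μ_k}` for a word `μ` of length `k`. -/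
def word {n k : ℕ} (μ : Fin k → Fin n) : O n := (List.ofFn fun j => S (μ j)).prod

/-- `𝒟_n^k`, generated by the projections `S_μ S_μ^*` with `|μ| = k`; as these are mutually
orthogonal with sum `1`, it is their linear span. -/
def diagLevel (n k : ℕ) : StarSubalgebra ℂ (O n) :=
  StarAlgebra.adjoin ℂ (Set.range fun μ : Fin k → Fin n => word μ * star (word μ))

/-- The diagonal `𝒟_n`, the norm closure of the union of the increasing chain `𝒟_n^k`. -/
def diag (n : ℕ) : StarSubalgebra ℂ (O n) := (⨆ k, diagLevel n k).topologicalClosure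

/-- The canonical endomorphism `φ(x) = ∑ S_i x S_i^*`. -/
def shift {n : ℕ} (x : O n) : O n := ∑ i, S i * x * star (S i)

/-- `φ^k(𝒟_n^1)`, as a subset of `𝒪_n`. -/
def shiftedDiag (n k : ℕ) : Set (O n) := shift^[k] '' (diagLevel n 1 : Set (O n))

/-- `α(φ^k(𝒟_n^1)) = φ^k(𝒟_n^1)` for all `k ≥ 0`. -/
def IsProductType {n : ℕ} (α : diag n ≃⋆ₐ[ℂ] diag n) : Prop :=
  ∀ k, (fun d : diag n => (α d : O n)) '' {d | (d : O n) ∈ shiftedDiag n k} = shiftedDiag n k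

/-- The actions of `α` on the algebras `φ^k(𝒟_n^1)`, each identified with `𝒟_n^1` through `φ^k`,
are eventually identical to one another: for all large `k` they are one and the same
automorphism `β` of `𝒟_n^1`. -/
def EventuallyIdentical {n : ℕ} (α : diag n ≃⋆ₐ[ℂ] diag n) : Prop :=
  ∃ β : diagLevel n 1 ≃⋆ₐ[ℂ] diagLevel n 1, ∀ᶠ k in atTop,
    ∀ (x : diagLevel n 1) (d : diag n),
      (d : O n) = shift^[k] (x : O n) → (α d : O n) = shift^[k] (β x : O n)

/-- The unital ⋆-endomorphism `ρ` of `𝒪_n` extends `α`. -/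
def Extends {n : ℕ} (ρ : O n →⋆ₐ[ℂ] O n) (α : diag n ≃⋆ₐ[ℂ] diag n) : Prop :=
  ∀ d : diag n, ρ (d : O n) = (α d : O n)

/-- The permutation unitary `∑ S_{π(μ)} S_μ^*`, over all words `μ` of length `k`. -/
def permUnitary {n k : ℕ} (π : Equiv.Perm (Fin k → Fin n)) : O n :=
  ∑ μ, word (π μ) * star (word μ)

/-- `θ` is a permutation automorphism: `θ = λ_w`, that is `θ(S_i) = w S_i` for all `i`, for a
permutation unitary `w`. -/
def IsPermutationAut {n : ℕ} (θ : O n ≃⋆ₐ[ℂ] O n) : Prop :=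
  ∃ (k : ℕ) (π : Equiv.Perm (Fin k → Fin n)), ∀ i : Fin n, θ (S i) = permUnitary π * S i

end Cuntz

end

noncomputable section

namespace Cuntz

open scoped CStarAlgebra

/-! ### Evaluation at a Cuntz family -/

/-! A product-type automorphism permutes, for each `k`, the projections `φ^k(S_i S_i^*)` by some
permutation `σ k`, and these projections generate the diagonal. So the data of `α` is the sequence
`σ`, and "eventually identical" means that `σ` is eventually constant.

If `σ k = τ` for `k ≥ K`, then `S_i ↦ S_{τ i}`, followed by conjugation with the permutation unitary
that applies `σ j * τ⁻¹` to the letters `j < K`, extends `α` (`truncAut`).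

Conversely, let `ρ` extend `α` and let `s` be a generator. Applying `ρ` to `φ^{k+1}(x) s = s φ^k(x)`
shows how `ρ s` moves spectral subspaces of the diagonal. In the permutative representation on the
tail class of a sequence `y`, the nonzero vector `ρ(s) e_y` is supported on sequences `x` with `x
(k+1) = (σ (k+1) * (σ k)⁻¹) (y k)` for all `k`. Such an `x` also has the same tail as `y` up to a
shift, so `y` satisfies a recursion. If `σ` changes infinitely often, some `y` satisfies none of
these countably many recursions (`exists_generic_sequence`), a contradiction
(`eventually_eq_of_hom`).

Every sequence of permutations does occur, through a pointwise norm limit of inner automorphisms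
(`productAut`); an alternating one gives an automorphism without extension. -/

/-- The representation of `𝒪_n` on `H` given by a Cuntz family. -/
def evalHom {n : ℕ} (F : Family n) : O n →⋆ₐ[ℂ] (H →L[ℂ] H) where
  toFun x := (x : Ambient n).1 F
  map_one' := rfl
  map_mul' _ _ := rfl
  map_zero' := rfl
  map_add' _ _ := rfl
  commutes' _ := rfl
  map_star' _ := rfl

@[simp] theorem evalHom_S {n : ℕ} (F : Family n) (i : Fin n) : evalHom F (S i) = F.T i := rfl

theorem evalHom_star {n : ℕ} (F : Family n) (x : O n) :
    evalHom F (star x) = star (evalHom F x) := rfl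

theorem ext_evalHom {n : ℕ} {x y : O n} (h : ∀ F : Family n, evalHom F x = evalHom F y) :
    x = y :=
  Subtype.ext (Subtype.ext (funext h))

/-- The range relation gives `∑ ‖T_i^* y‖² = ‖y‖²`. For `y = T_j x` the `j`-th term is `‖x‖² ≥
‖y‖²`, which leaves nothing for the others. -/
theorem Family.star_mul_of_ne {n : ℕ} (F : Family n) {i j : Fin n} (hij : i ≠ j) :
    star (F.T i) * F.T j = 0 := by
  have hsum : ∀ y : H, ∑ i, ‖star (F.T i) y‖ ^ 2 = ‖y‖ ^ 2 := by
    intro y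
    have h1 : (∑ i, ((‖star (F.T i) y‖ : ℂ)) ^ 2) = (‖y‖ : ℂ) ^ 2 := by
      have h2 := congrArg (fun A : H →L[ℂ] H => inner ℂ y (A y)) F.sum_range
      simp only [_root_.sum_apply, inner_sum, _root_.mul_apply_eq_comp,
        _root_.one_apply_eq_self] at h2
      rw [inner_self_eq_norm_sq_to_K] at h2
      refine Eq.trans (Finset.sum_congr rfl fun i _ => ?_) h2
      rw [ContinuousLinearMap.star_eq_adjoint, ← ContinuousLinearMap.adjoint_inner_left,
        inner_self_eq_norm_sq_to_K]
      rfl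
    exact_mod_cast h1
  have hiso : ∀ x : H, star (F.T j) (F.T j x) = x := fun x =>
    congrArg (fun A : H →L[ℂ] H => A x) (F.isometry j)
  ext1 x
  have h := hsum (F.T j x)
  have hnorm : ‖F.T j x‖ ≤ ‖x‖ := by
    simpa using (F.T j).le_of_opNorm_le (F.norm_le_one j) x
  rw [← Finset.add_sum_erase _ _ (Finset.mem_univ j), hiso] at h
  have h3 : ‖star (F.T i) (F.T j x)‖ ^ 2
      ≤ ∑ l ∈ Finset.univ.erase j, ‖star (F.T l) (F.T j x)‖ ^ 2 :=
    Finset.single_le_sum (f := fun l => ‖star (F.T l) (F.T j x)‖ ^ 2)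
      (fun l _ => by positivity) (Finset.mem_erase.2 ⟨hij, Finset.mem_univ i⟩)
  have h4 : ‖F.T j x‖ ^ 2 ≤ ‖x‖ ^ 2 := by gcongr
  have h5 : ‖star (F.T i) (F.T j x)‖ ^ 2 = 0 := le_antisymm (by linarith) (by positivity)
  simpa using h5

/-! ### The Cuntz relations -/

theorem star_S_mul_S {n : ℕ} (i j : Fin n) : star (S i) * S j = if i = j then (1 : O n) else 0 := by
  split_ifs with h
  · subst h
    exact ext_evalHom fun F => by simpa [evalHom_star] using F.isometry i
  · exact ext_evalHom fun F => by simpa [evalHom_star] using F.star_mul_of_ne h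

theorem sum_S_mul_star {n : ℕ} : ∑ i, S i * star (S i) = (1 : O n) :=
  ext_evalHom fun F => by simpa [evalHom_star] using F.sum_range

theorem eq_of_mul_S {n : ℕ} {x y : O n} (h : ∀ i, x * S i = y * S i) : x = y := by
  rw [← mul_one x, ← mul_one y, ← sum_S_mul_star, Finset.mul_sum, Finset.mul_sum]
  exact Finset.sum_congr rfl fun i _ => by rw [← mul_assoc, h, mul_assoc]

/-! ### The canonical endomorphism -/

theorem shift_mul_S {n : ℕ} (x : O n) (i : Fin n) : shift x * S i = S i * x := by
  simp [shift, Finset.sum_mul, mul_assoc, star_S_mul_S]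

/-- The canonical endomorphism as a `⋆`-homomorphism. -/
def shiftHom (n : ℕ) : O n →⋆ₐ[ℂ] O n where
  toFun := shift
  map_one' := by simp [shift, sum_S_mul_star]
  map_mul' x y := eq_of_mul_S fun i => by
    rw [shift_mul_S, mul_assoc, shift_mul_S, ← mul_assoc, ← mul_assoc, shift_mul_S]
  map_zero' := by simp [shift]
  map_add' x y := by simp [shift, mul_add, add_mul, Finset.sum_add_distrib]
  commutes' r := by
    simp [Algebra.algebraMap_eq_smul_one, shift, ← Finset.smul_sum, sum_S_mul_star]
  map_star' x := by simp [shift, mul_assoc]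

/-- The `k`-th power of the canonical endomorphism as a `⋆`-homomorphism. -/
def shiftPow (n k : ℕ) : O n →⋆ₐ[ℂ] O n where
  toFun := shift^[k]
  map_one' := Function.iterate_fixed (map_one (shiftHom n)) k
  map_mul' := by
    induction k with
    | zero => intro x y; rfl
    | succ k ih =>
      intro x y
      simp only [Function.iterate_succ_apply'] at ih ⊢
      rw [ih]; exact map_mul (shiftHom n) _ _
  map_zero' := Function.iterate_fixed (map_zero (shiftHom n)) k
  map_add' := by
    induction k with
    | zero => intro x y; rfl
    | succ k ih =>
      intro x y
      simp only [Function.iterate_succ_apply'] at ih ⊢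
      rw [ih]; exact map_add (shiftHom n) _ _
  commutes' r := Function.iterate_fixed (AlgHomClass.commutes (shiftHom n) r) k
  map_star' := by
    induction k with
    | zero => intro x; rfl
    | succ k ih =>
      intro x
      simp only [Function.iterate_succ_apply'] at ih ⊢
      rw [ih]; exact map_star (shiftHom n) _

theorem shiftPow_apply {n : ℕ} (k : ℕ) (x : O n) : shiftPow n k x = shift^[k] x := rfl

@[simp] theorem shiftPow_zero {n : ℕ} (x : O n) : shiftPow n 0 x = x := rfl

theorem shiftPow_succ {n : ℕ} (k : ℕ) (x : O n) :
    shiftPow n (k + 1) x = shift (shiftPow n k x) := Function.iterate_succ_apply' _ _ _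

theorem shiftPow_succ_mul_S {n : ℕ} (k : ℕ) (x : O n) (i : Fin n) :
    shiftPow n (k + 1) x * S i = S i * shiftPow n k x := by
  rw [shiftPow_succ, shift_mul_S]

theorem shift_injective {n : ℕ} (hn : 0 < n) : Function.Injective (shift : O n → O n) := by
  intro x y h
  have h1 : ∀ z : O n, star (S ⟨0, hn⟩) * (shift z * S ⟨0, hn⟩) = z := fun z => by
    rw [shift_mul_S, ← mul_assoc, star_S_mul_S, if_pos rfl, one_mul]
  rw [← h1 x, h, h1]

theorem shiftPow_injective {n : ℕ} (hn : 0 < n) (k : ℕ) : Function.Injective (shiftPow n k) :=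
  (shift_injective hn).iterate k

/-! ### Range projections -/

/-- The range projection `S_i S_i^*`. -/
def proj {n : ℕ} (i : Fin n) : O n := S i * star (S i)

theorem proj_mul_S {n : ℕ} (i j : Fin n) : proj i * S j = if i = j then S j else 0 := by
  rw [proj, mul_assoc, star_S_mul_S]
  split_ifs with h
  · rw [mul_one, h]
  · simp

theorem proj_mul_proj {n : ℕ} (i j : Fin n) : proj i * proj j = if i = j then proj j else 0 := by
  conv_lhs => rw [proj.eq_1 j, ← mul_assoc, proj_mul_S]
  split_ifs <;> simp [proj]

@[simp] theorem star_proj {n : ℕ} (i : Fin n) : star (proj i) = proj i := by simp [proj]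

theorem sum_proj {n : ℕ} : ∑ i, proj i = (1 : O n) := sum_S_mul_star

theorem shift_mul_proj {n : ℕ} (x : O n) (i : Fin n) : shift x * proj i = S i * x * star (S i) := by
  rw [proj, ← mul_assoc, shift_mul_S]

theorem proj_ne_zero {n : ℕ} [Nontrivial (O n)] (i : Fin n) : proj i ≠ 0 := by
  intro h
  have h1 : star (S i) * (proj i * S i) = (1 : O n) := by
    rw [proj_mul_S, if_pos rfl, star_S_mul_S, if_pos rfl]
  simp [h] at h1

theorem proj_injective {n : ℕ} [Nontrivial (O n)] : Function.Injective (proj : Fin n → O n) := by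
  intro i j h
  by_contra hij
  have h1 := proj_mul_proj i j
  rw [if_neg hij, ← h, proj_mul_proj, if_pos rfl] at h1
  exact proj_ne_zero i h1

/-! ### Words and permutation unitaries -/

@[simp] theorem word_zero {n : ℕ} (μ : Fin 0 → Fin n) : word μ = 1 := by simp [word]

theorem word_succ {n k : ℕ} (μ : Fin (k + 1) → Fin n) :
    word μ = S (μ 0) * word (Fin.tail μ) := by
  simp [word, List.ofFn_succ, Fin.tail]

theorem word_succ' {n k : ℕ} (μ : Fin (k + 1) → Fin n) :
    word μ = word (Fin.init μ) * S (μ (Fin.last k)) := by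
  rw [word, List.ofFn_succ', List.concat_eq_append, List.prod_append]
  simp [word, Fin.init]

theorem star_word_mul_word {n k : ℕ} (μ ν : Fin k → Fin n) :
    star (word μ) * word ν = if μ = ν then (1 : O n) else 0 := by
  induction k with
  | zero => simp [Subsingleton.elim μ ν]
  | succ k ih =>
    rw [word_succ, word_succ, star_mul, mul_assoc, ← mul_assoc (star (S (μ 0))), star_S_mul_S]
    have h : μ = ν ↔ μ 0 = ν 0 ∧ Fin.tail μ = Fin.tail ν := by
      conv_lhs => rw [← Fin.cons_self_tail μ, ← Fin.cons_self_tail ν, Fin.cons_inj]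
    split_ifs with h1 h2 h2
    · rw [one_mul, ih, if_pos (h.1 h2).2]
    · rw [one_mul, ih, if_neg fun h3 => h2 (h.2 ⟨h1, h3⟩)]
    · exact absurd (h.1 h2).1 h1
    · simp

/-- Iterates `eq_of_mul_S`. Permutation unitaries and `φ^j(S_i S_i^*)` act transparently on words,
so identities between them are tested there. -/
theorem eq_of_mul_word {n : ℕ} (k : ℕ) {x y : O n}
    (h : ∀ μ : Fin k → Fin n, x * word μ = y * word μ) : x = y := by
  induction k with
  | zero => simpa using h Fin.elim0
  | succ k ih =>
    refine ih fun μ => eq_of_mul_S fun i => ?_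
    have h1 := h (Fin.snoc μ i)
    rwa [word_succ', Fin.init_snoc, Fin.snoc_last, ← mul_assoc, ← mul_assoc] at h1

theorem permUnitary_mul_word {n k : ℕ} (π : Equiv.Perm (Fin k → Fin n)) (μ : Fin k → Fin n) :
    permUnitary π * word μ = word (π μ) := by
  simp [permUnitary, Finset.sum_mul, mul_assoc, star_word_mul_word]

theorem star_permUnitary {n k : ℕ} (π : Equiv.Perm (Fin k → Fin n)) :
    star (permUnitary π) = permUnitary π⁻¹ := by
  simp only [permUnitary, star_sum, star_mul, star_star]
  exact Fintype.sum_equiv π _ _ fun μ => by simp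

theorem permUnitary_mul {n k : ℕ} (π π' : Equiv.Perm (Fin k → Fin n)) :
    permUnitary π * permUnitary π' = permUnitary (π * π') :=
  eq_of_mul_word k fun μ => by simp [mul_assoc, permUnitary_mul_word]

theorem permUnitary_one {n k : ℕ} : permUnitary (1 : Equiv.Perm (Fin k → Fin n)) = 1 :=
  eq_of_mul_word k fun μ => by simp [permUnitary_mul_word]

theorem permUnitary_mem_unitary {n k : ℕ} (π : Equiv.Perm (Fin k → Fin n)) :
    permUnitary π ∈ unitary (O n) := by
  rw [Unitary.mem_iff, star_permUnitary, permUnitary_mul, permUnitary_mul]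
  simp [permUnitary_one]

theorem shiftPow_mul_word {n k : ℕ} (x : O n) (μ : Fin k → Fin n) :
    shiftPow n k x * word μ = word μ * x := by
  induction k generalizing x with
  | zero => simp
  | succ k ih =>
    rw [word_succ, ← mul_assoc, shiftPow_succ_mul_S, mul_assoc, ih, mul_assoc]

/-- `φ^j(S_i S_i^*)` tests whether the letter in position `j` is `i`: each leading letter is passed
by lowering the power of `φ` by one. -/
theorem shiftPow_proj_mul_word {n k : ℕ} (j : Fin k) (i : Fin n) (μ : Fin k → Fin n) :
    shiftPow n j (proj i) * word μ = if i = μ j then word μ else 0 := by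
  induction k with
  | zero => exact j.elim0
  | succ k ih =>
    rw [word_succ, ← mul_assoc]
    induction j using Fin.cases with
    | zero =>
      simp only [Fin.val_zero, shiftPow_zero, proj_mul_S]
      split_ifs <;> simp
    | succ j =>
      rw [Fin.val_succ, shiftPow_succ_mul_S, mul_assoc, ih]
      change _ = if i = Fin.tail μ j then _ else _
      split_ifs <;> simp

/-- The permutation of words of length `k` acting by `a j` on the `j`-th letter. -/
def letterPerm {n : ℕ} (a : ℕ → Equiv.Perm (Fin n)) (k : ℕ) : Equiv.Perm (Fin k → Fin n) :=
  Equiv.piCongrRight fun j => a j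

@[simp] theorem letterPerm_apply {n k : ℕ} (a : ℕ → Equiv.Perm (Fin n)) (μ : Fin k → Fin n)
    (j : Fin k) : letterPerm a k μ j = a j (μ j) := rfl

@[simp] theorem letterPerm_inv_apply {n k : ℕ} (a : ℕ → Equiv.Perm (Fin n)) (μ : Fin k → Fin n)
    (j : Fin k) : (letterPerm a k)⁻¹ μ j = (a j)⁻¹ (μ j) := rfl

/-- Conjugation by the permutation unitary of `letterPerm a k`. -/
def letterAut {n : ℕ} (a : ℕ → Equiv.Perm (Fin n)) (k : ℕ) : O n ≃⋆ₐ[ℂ] O n :=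
  Unitary.conjStarAlgAut ℂ (O n) ⟨permUnitary (letterPerm a k), permUnitary_mem_unitary _⟩

theorem letterAut_apply {n : ℕ} (a : ℕ → Equiv.Perm (Fin n)) (k : ℕ) (x : O n) :
    letterAut a k x = permUnitary (letterPerm a k) * x * permUnitary (letterPerm a k)⁻¹ := by
  rw [letterAut, Unitary.conjStarAlgAut_apply, ← star_permUnitary]

theorem letterAut_shiftPow_proj_of_lt {n : ℕ} (a : ℕ → Equiv.Perm (Fin n)) {j k : ℕ} (hj : j < k)
    (i : Fin n) : letterAut a k (shiftPow n j (proj i)) = shiftPow n j (proj (a j i)) := by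
  refine eq_of_mul_word k fun μ => ?_
  have h1 := shiftPow_proj_mul_word ⟨j, hj⟩ i ((letterPerm a k)⁻¹ μ)
  have h2 := shiftPow_proj_mul_word ⟨j, hj⟩ (a j i) μ
  simp only [letterPerm_inv_apply] at h1
  rw [letterAut_apply, mul_assoc, mul_assoc, permUnitary_mul_word, h1, h2]
  have h3 : i = (a j)⁻¹ (μ ⟨j, hj⟩) ↔ a j i = μ ⟨j, hj⟩ := by
    rw [Equiv.Perm.eq_inv_iff_eq]
  simp only [h3]
  split_ifs
  · rw [permUnitary_mul_word]; simp
  · simp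

/-- The relation `φ^k(x) S_μ = S_μ x` for `|μ| = k` makes `φ^k(x)` commute with permutation
unitaries of level `k`. -/
theorem letterAut_shiftPow_of_le {n : ℕ} (a : ℕ → Equiv.Perm (Fin n)) {j k : ℕ} (hj : k ≤ j)
    (x : O n) : letterAut a k (shiftPow n j x) = shiftPow n j x := by
  obtain ⟨m, rfl⟩ := Nat.exists_eq_add_of_le hj
  have h : shiftPow n (k + m) x = shiftPow n k (shiftPow n m x) :=
    Function.iterate_add_apply _ _ _ _
  refine eq_of_mul_word k fun μ => ?_
  rw [letterAut_apply, mul_assoc, mul_assoc, permUnitary_mul_word, h, shiftPow_mul_word,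
    ← mul_assoc, permUnitary_mul_word, shiftPow_mul_word]
  simp

/-! ### Relabelling the generators -/

/-- The Cuntz family obtained by permuting the isometries. -/
def Family.relabel {n : ℕ} (F : Family n) (σ : Equiv.Perm (Fin n)) : Family n where
  T i := F.T (σ i)
  isometry i := F.isometry (σ i)
  sum_range := (Equiv.sum_comp σ fun i => F.T i * star (F.T i)).trans F.sum_range

/-- Relabelling of the families, as an endomorphism of the ambient C⋆-algebra. -/
def ambientRelabel {n : ℕ} (σ : Equiv.Perm (Fin n)) : Ambient n →⋆ₐ[ℂ] Ambient n where
  toFun x := ⟨fun F => x.1 (F.relabel σ), memℓp_infty <| by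
    obtain ⟨C, hC⟩ := memℓp_infty_iff.1 x.2
    exact ⟨C, by rintro _ ⟨F, rfl⟩; exact hC ⟨F.relabel σ, rfl⟩⟩⟩
  map_one' := rfl
  map_mul' _ _ := rfl
  map_zero' := rfl
  map_add' _ _ := rfl
  commutes' _ := rfl
  map_star' _ := rfl

theorem ambientRelabel_mem {n : ℕ} (σ : Equiv.Perm (Fin n)) (x : O n) :
    ambientRelabel σ (x : Ambient n) ∈ algebra n := by
  have hcont : Continuous (ambientRelabel (n := n) σ) := map_continuous (ambientRelabel σ)
  have hle : algebra n ≤ (algebra n).comap (ambientRelabel σ) := by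
    refine StarSubalgebra.topologicalClosure_minimal (StarAlgebra.adjoin_le ?_)
      ((StarSubalgebra.isClosed_topologicalClosure _).preimage hcont)
    rintro _ ⟨i, rfl⟩
    exact (S (σ i)).2
  exact hle x.2

/-- The endomorphism of `𝒪_n` with `S_i ↦ S_{σ i}`. -/
def relabelHom {n : ℕ} (σ : Equiv.Perm (Fin n)) : O n →⋆ₐ[ℂ] O n :=
  ((ambientRelabel σ).comp (algebra n).subtype).codRestrict (algebra n) (ambientRelabel_mem σ)

theorem evalHom_relabelHom {n : ℕ} (σ : Equiv.Perm (Fin n)) (F : Family n) (x : O n) :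
    evalHom F (relabelHom σ x) = evalHom (F.relabel σ) x := rfl

/-- The automorphism of `𝒪_n` with `S_i ↦ S_{σ i}`. -/
def relabel {n : ℕ} (σ : Equiv.Perm (Fin n)) : O n ≃⋆ₐ[ℂ] O n :=
  StarAlgEquiv.ofStarAlgHom (relabelHom σ) (relabelHom σ⁻¹)
    (StarAlgHom.ext fun x => ext_evalHom fun F => by
      simp [evalHom_relabelHom, Family.relabel])
    (StarAlgHom.ext fun x => ext_evalHom fun F => by
      simp [evalHom_relabelHom, Family.relabel])

@[simp] theorem relabel_S {n : ℕ} (σ : Equiv.Perm (Fin n)) (i : Fin n) :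
    relabel σ (S i) = S (σ i) := rfl

theorem relabel_proj {n : ℕ} (σ : Equiv.Perm (Fin n)) (i : Fin n) :
    relabel σ (proj i) = proj (σ i) := by
  rw [proj, map_mul, map_star, relabel_S, proj]

theorem relabel_shiftPow {n : ℕ} (σ : Equiv.Perm (Fin n)) (k : ℕ) (x : O n) :
    relabel σ (shiftPow n k x) = shiftPow n k (relabel σ x) := by
  induction k with
  | zero => rfl
  | succ k ih =>
    rw [shiftPow_succ, shiftPow_succ, ← ih, shift, shift, map_sum]
    simp only [map_mul, map_star, relabel_S]
    exact Equiv.sum_comp σ fun i => S i * relabel σ (shiftPow n k x) * star (S i)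

/-! ### The diagonal -/

theorem word_one {n : ℕ} (μ : Fin 1 → Fin n) : word μ = S (μ 0) := by
  rw [word_succ, word_zero, mul_one]

theorem proj_mem_diagLevel_one {n : ℕ} (i : Fin n) : proj i ∈ diagLevel n 1 :=
  StarAlgebra.subset_adjoin ℂ _ ⟨fun _ => i, by simp only [word_one, proj]⟩

theorem shift_mem_diagLevel_succ {n k : ℕ} {x : O n} (hx : x ∈ diagLevel n k) :
    shift x ∈ diagLevel n (k + 1) := by
  have hle : diagLevel n k ≤ (diagLevel n (k + 1)).comap (shiftHom n) := by
    refine StarAlgebra.adjoin_le ?_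
    rintro _ ⟨μ, rfl⟩
    change shift _ ∈ diagLevel n (k + 1)
    refine sum_mem fun i _ => StarAlgebra.subset_adjoin ℂ _ ⟨Fin.cons i μ, ?_⟩
    simp only [word_succ, Fin.cons_zero, Fin.tail_cons, star_mul, mul_assoc]
  exact hle hx

theorem shiftPow_mem_diagLevel {n k : ℕ} {x : O n} (hx : x ∈ diagLevel n 1) :
    shiftPow n k x ∈ diagLevel n (k + 1) := by
  induction k with
  | zero => exact hx
  | succ k ih => rw [shiftPow_succ]; exact shift_mem_diagLevel_succ ih

theorem diagLevel_le_diag (n k : ℕ) : diagLevel n k ≤ diag n :=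
  (le_iSup (diagLevel n) k).trans (StarSubalgebra.le_topologicalClosure _)

theorem shiftPow_mem_diag {n : ℕ} (k : ℕ) {x : O n} (hx : x ∈ diagLevel n 1) :
    shiftPow n k x ∈ diag n :=
  diagLevel_le_diag n _ (shiftPow_mem_diagLevel hx)

/-- `φ^k(S_i S_i^*)` as an element of the diagonal. -/
def diagProj {n : ℕ} (k : ℕ) (i : Fin n) : diag n :=
  ⟨shiftPow n k (proj i), shiftPow_mem_diag k (proj_mem_diagLevel_one i)⟩

theorem isClosed_diag (n : ℕ) : IsClosed (diag n : Set (O n)) :=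
  StarSubalgebra.isClosed_topologicalClosure _

/-- Splitting off the first letter, `S_μ S_μ^* = φ(S_ν S_ν^*) S_i S_i^*` with `μ = iν`; induction on
the length shows that the projections `φ^k(S_i S_i^*)` generate the diagonal. -/
theorem diag_le_of_shiftPow_proj_mem {n : ℕ} {B : StarSubalgebra ℂ (O n)}
    (hB : IsClosed (B : Set (O n))) (h : ∀ k i, shiftPow n k (proj i) ∈ B) : diag n ≤ B := by
  set A : StarSubalgebra ℂ (O n) :=
    StarAlgebra.adjoin ℂ {x | ∃ k i, x = shiftPow n k (proj i)} with hA
  have hAB : A ≤ B := StarAlgebra.adjoin_le (by rintro _ ⟨k, i, rfl⟩; exact h k i)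
  have hAshift : A ≤ A.comap (shiftHom n) := StarAlgebra.adjoin_le <| by
    rintro _ ⟨k, i, rfl⟩
    exact StarAlgebra.subset_adjoin ℂ _ ⟨k + 1, i, (shiftPow_succ k _).symm⟩
  have hlevel : ∀ k, diagLevel n k ≤ A := by
    intro k
    refine StarAlgebra.adjoin_le ?_
    rintro _ ⟨μ, rfl⟩
    induction k with
    | zero => simp
    | succ k ih =>
      have h1 : word μ * star (word μ)
          = shift (word (Fin.tail μ) * star (word (Fin.tail μ))) * proj (μ 0) := by
        rw [shift_mul_proj, word_succ, star_mul]
        simp only [mul_assoc]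
      change word μ * star (word μ) ∈ A
      rw [h1]
      exact mul_mem (hAshift (ih (Fin.tail μ))) (StarAlgebra.subset_adjoin ℂ _ ⟨0, μ 0, rfl⟩)
  exact StarSubalgebra.topologicalClosure_minimal ((iSup_le hlevel).trans hAB) hB

theorem continuous_of_diag {n : ℕ} (f : diag n →⋆ₐ[ℂ] O n) : Continuous f := by
  have := isClosed_diag n
  let _ : CStarAlgebra (diag n) := StarSubalgebra.cstarAlgebra (diag n)
  exact map_continuous f

theorem diagHom_ext {n : ℕ} {f g : diag n →⋆ₐ[ℂ] O n}
    (h : ∀ k i, f (diagProj k i) = g (diagProj k i)) : f = g := by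
  -- The maps live only on the diagonal, so closedness in `𝒪_n` comes from automatic continuity and
  -- the closed embedding.
  have hcl : IsClosed ((StarAlgHom.equalizer f g).map (diag n).subtype : Set (O n)) := by
    have h1 : ((StarAlgHom.equalizer f g).map (diag n).subtype : Set (O n))
        = Subtype.val '' {x : diag n | f x = g x} := rfl
    rw [h1]
    exact (isClosed_diag n).isClosedEmbedding_subtypeVal.isClosedMap _
      (isClosed_eq (continuous_of_diag f) (continuous_of_diag g))
  have hle := diag_le_of_shiftPow_proj_mem hcl fun k i => ⟨diagProj k i, h k i, rfl⟩
  ext1 d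
  obtain ⟨d', hd', hdd⟩ := hle d.2
  obtain rfl : d' = d := Subtype.ext hdd
  exact hd'

theorem sum_smul_proj_mul_proj {n : ℕ} (c : Fin n → ℂ) (j : Fin n) :
    (∑ i, c i • proj i) * proj j = c j • (proj j : O n) := by
  simp [Finset.sum_mul, proj_mul_proj]

theorem mem_diagLevel_one {n : ℕ} {x : O n} :
    x ∈ diagLevel n 1 ↔ ∃ c : Fin n → ℂ, x = ∑ i, c i • proj i := by
  constructor
  · intro hx
    induction hx using StarAlgebra.adjoin_induction with
    | mem x h =>
      obtain ⟨μ, rfl⟩ := h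
      exact ⟨Pi.single (μ 0) 1, by simp [word_one, Pi.single_apply, proj]⟩
    | algebraMap r =>
      exact ⟨fun _ => r, by rw [← Finset.smul_sum, sum_proj, Algebra.algebraMap_eq_smul_one]⟩
    | add x y _ _ hx hy =>
      obtain ⟨c, rfl⟩ := hx
      obtain ⟨d, rfl⟩ := hy
      exact ⟨c + d, by simp [add_smul, Finset.sum_add_distrib]⟩
    | mul x y _ _ hx hy =>
      obtain ⟨c, rfl⟩ := hx
      obtain ⟨d, rfl⟩ := hy
      refine ⟨d * c, ?_⟩
      rw [Finset.mul_sum]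
      refine Finset.sum_congr rfl fun i _ => ?_
      rw [mul_smul_comm, sum_smul_proj_mul_proj, smul_smul, Pi.mul_apply]
    | star x _ hx =>
      obtain ⟨c, rfl⟩ := hx
      exact ⟨star c, by simp [star_sum]⟩
  · rintro ⟨c, rfl⟩
    exact sum_mem fun i _ => (diagLevel n 1).smul_mem (proj_mem_diagLevel_one i) _

/-! ### Product-type automorphisms permute the projections `φ^k(S_i S_i^*)` -/

/-- The coefficients are `0` or `1`, so the `x i` partition the `n` minimal projections into `n`
nonempty blocks; each block is a singleton. -/
theorem exists_perm_of_orthogonal {n : ℕ} [Nontrivial (O n)] {x : Fin n → O n}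
    (hmem : ∀ i, x i ∈ diagLevel n 1) (hne : ∀ i, x i ≠ 0) (hsum : ∑ i, x i = 1)
    (hmul : ∀ i j, x i * x j = if i = j then x j else 0) :
    ∃ σ : Equiv.Perm (Fin n), ∀ i, x i = proj (σ i) := by
  choose c hc using fun i => mem_diagLevel_one.1 (hmem i)
  have hcp : ∀ i j, x i * proj j = c i j • proj j := fun i j => by
    rw [hc i, sum_smul_proj_mul_proj]
  have hinj : ∀ (j : Fin n) (a b : ℂ), a • (proj j : O n) = b • proj j → a = b :=
    fun j a b h => smul_left_injective ℂ (proj_ne_zero j) h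
  have hcmul : ∀ i i' j, c i j * c i' j = if i = i' then c i' j else 0 := by
    intro i i' j
    refine hinj j _ _ ?_
    rw [mul_comm, mul_smul, ← hcp i, ← mul_smul_comm, ← hcp i', ← mul_assoc, hmul]
    split_ifs
    · exact hcp _ _
    · simp
  have hcsum : ∀ j, ∑ i, c i j = 1 := by
    intro j
    refine hinj j _ _ ?_
    rw [Finset.sum_smul, ← Finset.sum_congr rfl fun i _ => hcp i j, ← Finset.sum_mul, hsum]
    simp
  have hex : ∀ j, ∃ i, c i j ≠ 0 := by
    intro j
    by_contra! h
    simpa [h] using hcsum j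
  -- `g j` is the block containing `j`; nonvanishing of all `x i` makes `g` onto, hence bijective.
  choose g hg using hex
  have hc1 : ∀ j i, c i j = if g j = i then 1 else 0 := by
    intro j i
    have h := hcmul (g j) i j
    split_ifs at h ⊢ with hi
    · subst hi
      exact mul_left_cancel₀ (hg j) (by rw [h, mul_one])
    · exact (mul_eq_zero.1 h).resolve_left (hg j)
  have hsurj : Function.Surjective g := by
    intro i
    by_contra! h
    exact hne i (by rw [hc i]; simp [hc1, h])
  have hbij : Function.Bijective g := Finite.injective_iff_bijective.1
    (Finite.injective_iff_surjective.2 hsurj)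
  refine ⟨(Equiv.ofBijective g hbij).symm, fun i => ?_⟩
  rw [hc i]
  have h2 : ∀ j, g j = i ↔ (Equiv.ofBijective g hbij).symm i = j := fun j => by
    rw [Equiv.symm_apply_eq, Equiv.ofBijective_apply, eq_comm]
  simp [hc1, h2]

theorem IsProductType.exists_perm {n : ℕ} [Nontrivial (O n)] (hn : 0 < n)
    {α : diag n ≃⋆ₐ[ℂ] diag n} (hα : IsProductType α) :
    ∃ σ : ℕ → Equiv.Perm (Fin n), ∀ k i,
      (α (diagProj k i) : O n) = shiftPow n k (proj (σ k i)) := by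
  suffices h : ∀ k, ∃ σ : Equiv.Perm (Fin n), ∀ i,
      (α (diagProj k i) : O n) = shiftPow n k (proj (σ i)) from ⟨_, fun k => (h k).choose_spec⟩
  intro k
  have hx : ∀ i : Fin n, ∃ x ∈ diagLevel n 1, shiftPow n k x = α (diagProj k i) := by
    intro i
    have h1 : (α (diagProj k i) : O n) ∈ shiftedDiag n k := by
      rw [← hα k]
      exact ⟨diagProj k i, ⟨proj i, proj_mem_diagLevel_one i, rfl⟩, rfl⟩
    obtain ⟨x, hx, hxe⟩ := h1
    exact ⟨x, hx, hxe⟩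
  choose x hxmem hx using hx
  have hinj := shiftPow_injective hn k
  have hproj : ∀ i j : Fin n,
      diagProj k i * diagProj k j = if i = j then diagProj k j else 0 := by
    intro i j
    refine Subtype.ext ?_
    change shiftPow n k (proj i) * shiftPow n k (proj j) = _
    rw [← map_mul, proj_mul_proj]
    split_ifs
    · rfl
    · exact map_zero _
  obtain ⟨σ, hσ⟩ := exists_perm_of_orthogonal (x := x) hxmem
    (fun i h => by
      have h1 := hx i
      rw [h, map_zero] at h1
      have h2 : α (diagProj k i) = 0 := Subtype.ext h1.symm
      have h3 : diagProj k i = 0 := by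
        rw [← α.symm_apply_apply (diagProj k i), h2, map_zero]
      have h4 : shiftPow n k (proj i) = 0 := congrArg Subtype.val h3
      exact proj_ne_zero i (hinj (h4.trans (map_zero _).symm)))
    (hinj (by
      have h1 : ∑ i, diagProj (n := n) k i = 1 := Subtype.ext (by
        rw [AddSubmonoidClass.coe_finsetSum]
        change ∑ i, shiftPow n k (proj i) = 1
        rw [← map_sum, sum_proj, map_one])
      rw [map_sum, map_one, Finset.sum_congr rfl fun i _ => hx i,
        ← AddSubmonoidClass.coe_finsetSum, ← map_sum, h1, map_one]
      rfl))
    (fun i j => hinj (by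
      rw [map_mul, hx, hx, ← MulMemClass.coe_mul, ← map_mul, hproj]
      split_ifs
      · exact (hx j).symm
      · simp))
  exact ⟨σ, fun i => by rw [← hx, hσ]⟩

/-! ### Permutative representations -/

/-- The standard basis vectors of `H`. -/
def basisVec (m : ℕ) : H := lp.single 2 m (1 : ℂ)

theorem inner_basisVec (m : ℕ) (v : H) : inner ℂ (basisVec m) v = v m := by
  simp [basisVec, lp.inner_single_left]

theorem inner_basisVec_basisVec (l m : ℕ) :
    inner ℂ (basisVec l) (basisVec m) = if l = m then (1 : ℂ) else 0 := by
  rw [inner_basisVec, basisVec]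
  split_ifs with h
  · rw [h, lp.single_apply_self]
  · rw [lp.single_apply_ne _ _ _ h]

theorem ext_basisVec {v w : H} (h : ∀ m, inner ℂ (basisVec m) v = inner ℂ (basisVec m) w) :
    v = w :=
  lp.ext (funext fun m => by simpa only [inner_basisVec] using h m)

theorem ext_clm_basisVec {A B : H →L[ℂ] H} (h : ∀ m, A (basisVec m) = B (basisVec m)) :
    A = B :=
  lp.ext_continuousLinearMap (by simp) fun m => by
    exact ContinuousLinearMap.ext_ring (h m)

theorem exists_isometry_of_injective {f : ℕ → ℕ} (hf : Function.Injective f) :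
    ∃ T : H →L[ℂ] H, star T * T = 1 ∧ ∀ m, T (basisVec m) = basisVec (f m) := by
  have hv : Orthonormal ℂ fun m => basisVec (f m) := by
    rw [orthonormal_iff_ite]
    intro i j
    rw [inner_basisVec_basisVec]
    simp only [hf.eq_iff]
  refine ⟨hv.orthogonalFamily.linearIsometry.toContinuousLinearMap, ?_, fun m => ?_⟩
  · exact (ContinuousLinearMap.isometry_iff_adjoint_comp_self _).1
      hv.orthogonalFamily.linearIsometry.isometry
  · exact (hv.orthogonalFamily.linearIsometry_apply_single (1 : ℂ)).trans (by simp)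

/-- Bijectivity of `s` means that the isometries permute basis vectors and their ranges split the
basis, which is the Cuntz relation. -/
theorem exists_family_of_equiv {n : ℕ} (s : Fin n × ℕ ≃ ℕ) :
    ∃ F : Family n, ∀ i m, F.T i (basisVec m) = basisVec (s (i, m)) := by
  choose T hT1 hT2 using fun i : Fin n => exists_isometry_of_injective (f := fun m => s (i, m))
    fun a b h => by simpa using h
  refine ⟨⟨T, hT1, ext_clm_basisVec fun l => ?_⟩, hT2⟩
  obtain ⟨⟨j, k⟩, rfl⟩ := s.surjective l
  have h1 : ∀ i, star (T i) (basisVec (s (j, k))) = if i = j then basisVec k else 0 := by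
    intro i
    refine ext_basisVec fun m => ?_
    rw [ContinuousLinearMap.star_eq_adjoint, ContinuousLinearMap.adjoint_inner_right, hT2,
      inner_basisVec_basisVec]
    split_ifs with h2 h3 h3
    · obtain ⟨-, rfl⟩ := Prod.mk.inj (s.injective h2)
      rw [inner_basisVec_basisVec, if_pos rfl]
    · exact absurd (Prod.mk.inj (s.injective h2)).1 h3
    · rw [inner_basisVec_basisVec, if_neg fun h4 => h2 (by rw [h3, h4])]
    · simp
  rw [_root_.sum_apply, Finset.sum_eq_single j]
  · rw [_root_.mul_apply_eq_comp, h1, if_pos rfl, hT2]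
    rfl
  · intro i _ hi
    rw [_root_.mul_apply_eq_comp, h1, if_neg hi, map_zero]
  · simp

theorem countable_of_determined {α : Type*} [Finite α] {A : Set (ℕ → α)} (p : ℕ)
    (h : ∀ x ∈ A, ∀ x' ∈ A, (∀ k < p, x k = x' k) → x = x') : A.Countable := by
  refine Set.countable_of_injective_of_countable_image
    (f := fun (x : ℕ → α) (k : Fin p) => x k) (fun x hx x' hx' hxx => ?_) (Set.to_countable _)
  exact h x hx x' hx' fun k hk => congrFun hxx ⟨k, hk⟩

/-- The sequences with the same tail as `y`, up to a shift. -/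
def TailClass {α : Type*} (y : ℕ → α) : Type _ :=
  {x : ℕ → α // ∃ p q, ∀ j, x (p + j) = y (q + j)}

/-- Splitting off the first letter of a sequence. -/
def TailClass.consEquiv {α : Type*} (y : ℕ → α) : α × TailClass y ≃ TailClass y where
  toFun z := ⟨fun k => Nat.casesOn k z.1 z.2.1, by
    obtain ⟨i, x, p, q, h⟩ := z
    exact ⟨p + 1, q, fun j => by rw [Nat.add_right_comm]; exact h j⟩⟩
  invFun x := (x.1 0, ⟨fun k => x.1 (k + 1), by
    obtain ⟨x, p, q, h⟩ := x
    refine ⟨p, q + 1, fun j => ?_⟩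
    rw [show q + 1 + j = q + (j + 1) by omega, ← h]
    rfl⟩)
  left_inv _ := rfl
  right_inv x := Subtype.ext (funext fun k => by cases k <;> rfl)

instance TailClass.countable {α : Type*} [Finite α] (y : ℕ → α) : Countable (TailClass y) := by
  have h : {x : ℕ → α | ∃ p q, ∀ j, x (p + j) = y (q + j)}.Countable := by
    simp only [Set.ofPred_exists]
    refine Set.countable_iUnion fun p => Set.countable_iUnion fun q =>
      countable_of_determined p fun x hx x' hx' h => funext fun k => ?_
    by_cases hk : k < p
    · exact h k hk
    · obtain ⟨j, rfl⟩ := Nat.exists_eq_add_of_le (not_lt.1 hk)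
      exact (hx j).trans (hx' j).symm
  exact h.to_subtype

/-- A finite cardinality `c > 0` would satisfy `n c = c` by `TailClass.consEquiv`. Together with
countability this lets the class label the basis of `H`. -/
theorem TailClass.infinite {n : ℕ} (hn : 2 ≤ n) (y : ℕ → Fin n) : Infinite (TailClass y) := by
  by_contra hfin
  rw [not_infinite_iff_finite] at hfin
  have hne : Nonempty (TailClass y) := ⟨⟨y, 0, 0, fun _ => rfl⟩⟩
  have h := Nat.card_congr (TailClass.consEquiv y)
  rw [Nat.card_prod, Nat.card_eq_fintype_card, Fintype.card_fin] at h
  have hpos : 0 < Nat.card (TailClass y) := Nat.card_pos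
  nlinarith

/-- A Cuntz family acting on an orthonormal basis labelled by the tail class of `y` by prepending
letters. -/
theorem exists_tail_family {n : ℕ} (hn : 2 ≤ n) (y : ℕ → Fin n) :
    ∃ (F : Family n) (w : ℕ → ℕ → Fin n),
      (∀ m, ∃ m', F.T (w m 0) (basisVec m') = basisVec m ∧ ∀ k, w m (k + 1) = w m' k) ∧
      (∃ m, w m = y) ∧ ∀ m, ∃ p q, ∀ j, w m (p + j) = y (q + j) := by
  have := TailClass.infinite hn y
  obtain ⟨_⟩ := nonempty_denumerable (TailClass y)
  obtain ⟨e⟩ : Nonempty (TailClass y ≃ ℕ) := ⟨Denumerable.eqv _⟩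
  obtain ⟨F, hF⟩ := exists_family_of_equiv
    (((Equiv.refl (Fin n)).prodCongr e.symm).trans ((TailClass.consEquiv y).trans e))
  refine ⟨F, fun m => (e.symm m).1, fun m => ?_, ⟨e ⟨y, 0, 0, fun _ => rfl⟩,
      congrArg Subtype.val (e.symm_apply_apply _)⟩,
    fun m => (e.symm m).2⟩
  refine ⟨e ((TailClass.consEquiv y).symm (e.symm m)).2, ?_, fun k => ?_⟩
  · rw [hF]
    congr 1
    have h : ((e.symm m).1 0, ((TailClass.consEquiv y).symm (e.symm m)).2)
      = (TailClass.consEquiv y).symm (e.symm m) := rfl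
    simp [h]
  · exact (congrFun (congrArg Subtype.val
      (e.symm_apply_apply ((TailClass.consEquiv y).symm (e.symm m)).2)) k).symm

theorem nontrivial_O {n : ℕ} (hn : 2 ≤ n) : Nontrivial (O n) := by
  obtain ⟨F, -⟩ := exists_tail_family hn fun _ => ⟨0, by omega⟩
  exact (evalHom F).toRingHom.domain_nontrivial

theorem evalHom_shiftPow_proj_basisVec {n : ℕ} {F : Family n} {w : ℕ → ℕ → Fin n}
    (hw : ∀ m, ∃ m', F.T (w m 0) (basisVec m') = basisVec m ∧ ∀ k, w m (k + 1) = w m' k)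
    (k : ℕ) (i : Fin n) (m : ℕ) :
    evalHom F (shiftPow n k (proj i)) (basisVec m) = if i = w m k then basisVec m else 0 := by
  induction k generalizing m with
  | zero =>
    obtain ⟨m', hm', -⟩ := hw m
    rw [← hm', ← evalHom_S, ← _root_.mul_apply_eq_comp, ← map_mul, shiftPow_zero, proj_mul_S]
    split_ifs with h
    · rfl
    · simp
  | succ k ih =>
    obtain ⟨m', hm', hk⟩ := hw m
    rw [← hm', ← evalHom_S, ← _root_.mul_apply_eq_comp, ← map_mul, shiftPow_succ_mul_S, map_mul,
      _root_.mul_apply_eq_comp, ih, hk]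
    split_ifs <;> simp

theorem evalHom_shiftPow_proj_apply {n : ℕ} {F : Family n} {w : ℕ → ℕ → Fin n}
    (hw : ∀ m, ∃ m', F.T (w m 0) (basisVec m') = basisVec m ∧ ∀ k, w m (k + 1) = w m' k)
    (k : ℕ) (i : Fin n) (v : H) (m : ℕ) :
    evalHom F (shiftPow n k (proj i)) v m = if i = w m k then v m else 0 := by
  have hsa : star (evalHom F (shiftPow n k (proj i))) = evalHom F (shiftPow n k (proj i)) := by
    rw [← evalHom_star, ← map_star, star_proj]
  rw [← inner_basisVec, ← hsa, ContinuousLinearMap.star_eq_adjoint,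
    ContinuousLinearMap.adjoint_inner_right, evalHom_shiftPow_proj_basisVec hw]
  split_ifs
  · exact inner_basisVec _ _
  · exact inner_zero_left _

/-! ### Obstruction to extending -/

/-- For `p ≠ q` the recursion determines `y` from finitely many entries, so only countably many `y`
are bad. For `p = q` it suffices that `y k` is moved whenever `τ k ≠ 1`. Two such letters are
available at each `k`, hence uncountably many candidates. -/
theorem exists_generic_sequence {n : ℕ} (hn : 2 ≤ n) {τ : ℕ → Equiv.Perm (Fin n)}
    (hτ : ∃ᶠ k in atTop, τ k ≠ 1) :
    ∃ y : ℕ → Fin n, ∀ p q, ∃ j, y (q + j) ≠ τ (p + j) (y (p + j)) := by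
  have := Fin.nontrivial_iff_two_le.2 hn
  have hbc : ∀ k, ∃ b c : Fin n, b ≠ c ∧ (τ k ≠ 1 → τ k b ≠ b ∧ τ k c ≠ c) := by
    intro k
    by_cases h : τ k = 1
    · obtain ⟨b, c, hbc⟩ := exists_pair_ne (Fin n)
      exact ⟨b, c, hbc, fun h' => absurd h h'⟩
    · obtain ⟨b, hb⟩ : ∃ b, τ k b ≠ b := by
        by_contra! h'
        exact h (Equiv.ext h')
      exact ⟨b, τ k b, hb.symm, fun _ => ⟨hb, fun h' => hb ((τ k).injective h')⟩⟩
  choose b c hbc hmoved using hbc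
  let f : (ℕ → Bool) → ℕ → Fin n := fun ε k => if ε k then b k else c k
  have hf : Function.Injective f := by
    intro ε ε' h
    funext k
    have h1 : (if ε k then b k else c k) = if ε' k then b k else c k := congrFun h k
    have h2 := hbc k
    cases h3 : ε k <;> cases h4 : ε' k <;> simp_all
  let bad : Set (ℕ → Fin n) :=
    ⋃ (p : ℕ) (q : ℕ) (_ : p ≠ q), {y | ∀ j, y (q + j) = τ (p + j) (y (p + j))}
  have hbad : bad.Countable := by
    refine Set.countable_iUnion fun p => Set.countable_iUnion fun q =>
      Set.countable_iUnion fun hpq => countable_of_determined (max p q) ?_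
    intro y hy y' hy' h
    funext k
    induction k using Nat.strong_induction_on with
    | _ k ih =>
      by_cases hk : k < max p q
      · exact h k hk
      -- The entry with the larger index is determined by the earlier one, directly if `p < q` and
      -- by inverting `τ (p + j)` if `q < p`.
      · rcases lt_or_gt_of_ne hpq with hlt | hlt
        · obtain ⟨j, rfl⟩ := Nat.exists_eq_add_of_le (show q ≤ k by omega)
          rw [hy j, hy' j, ih (p + j) (by omega)]
        · obtain ⟨j, rfl⟩ := Nat.exists_eq_add_of_le (show p ≤ k by omega)
          refine (τ (p + j)).injective ?_
          rw [← hy j, ← hy' j, ih (q + j) (by omega)]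
  obtain ⟨ε, hε⟩ : ∃ ε, f ε ∉ bad := by
    by_contra! h
    have h1 : (Set.univ : Set (ℕ → Bool)).Countable :=
      (hbad.preimage_of_injOn hf.injOn).mono fun ε _ => h ε
    have := Set.countable_univ_iff.1 h1
    -- Cantor's diagonal argument.
    obtain ⟨g, hg⟩ := exists_surjective_nat (ℕ → Bool)
    obtain ⟨m, hm⟩ := hg fun k => !g k k
    simpa using congrFun hm m
  refine ⟨f ε, fun p q => ?_⟩
  by_cases hpq : p = q
  · subst hpq
    obtain ⟨k, hk, hk1⟩ := (frequently_atTop.1 hτ) p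
    obtain ⟨j, rfl⟩ := Nat.exists_eq_add_of_le hk
    refine ⟨j, fun h => ?_⟩
    have h2 := hmoved _ hk1
    by_cases h3 : ε (p + j) = true
    · exact h2.1 (by simpa [f, h3] using h.symm)
    · exact h2.2 (by simpa [f, h3] using h.symm)
  · by_contra! h
    exact hε (Set.mem_iUnion.2 ⟨p, Set.mem_iUnion.2 ⟨q, Set.mem_iUnion.2 ⟨hpq, h⟩⟩⟩)

/-- Only the values of `ρ` on the diagonal projections and the fact that `ρ s` is an isometry
intertwining them are used. -/
theorem eventually_eq_of_hom {n : ℕ} (hn : 2 ≤ n) {σ : ℕ → Equiv.Perm (Fin n)}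
    {ρ : O n →⋆ₐ[ℂ] O n}
    (hρ : ∀ k i, ρ (shiftPow n k (proj i)) = shiftPow n k (proj (σ k i))) :
    ∀ᶠ k in atTop, σ (k + 1) = σ k := by
  by_contra hcon
  have hτ : ∃ᶠ k in atTop, σ (k + 1) * (σ k)⁻¹ ≠ 1 := by
    simpa only [ne_eq, mul_inv_eq_one] using not_eventually.1 hcon
  obtain ⟨y, hy⟩ := exists_generic_sequence hn hτ
  obtain ⟨F, w, hw, ⟨m₀, hm₀⟩, htail⟩ := exists_tail_family hn y
  set s : O n := S ⟨0, by omega⟩ with hs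
  set v : H := evalHom F (ρ s) (basisVec m₀) with hv
  have hv0 : v ≠ 0 := by
    intro h0
    have h1 : evalHom F (ρ (star s * s)) (basisVec m₀) = 0 := by
      rw [map_mul, map_mul, _root_.mul_apply_eq_comp, ← hv, h0, map_zero]
    rw [hs, star_S_mul_S, if_pos rfl, map_one, map_one, _root_.one_apply_eq_self] at h1
    have h2 := inner_basisVec_basisVec m₀ m₀
    simp [h1] at h2
  obtain ⟨m, hm⟩ : ∃ m, v m ≠ 0 := by
    by_contra! h
    exact hv0 (lp.ext (funext h))
  -- `e_y` is fixed by `φ^k(S_i S_i^*)` for `i = y k`, so `v` is fixed by the image projection one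
  -- level up; a nonzero coordinate `m` must then carry the matching letter.
  have hstep : ∀ k, w m (k + 1) = (σ (k + 1) * (σ k)⁻¹) (y k) := by
    intro k
    set j := (σ k)⁻¹ (y k) with hj
    have h1 : shiftPow n (k + 1) (proj (σ (k + 1) j)) * ρ s = ρ s * shiftPow n k (proj (y k)) := by
      have h2 : y k = σ k j := by simp [hj]
      rw [h2, ← hρ, ← hρ, ← map_mul, ← map_mul, hs, shiftPow_succ_mul_S]
    have h3 := congrArg (fun A : O n => evalHom F A (basisVec m₀) m) h1
    simp only [map_mul, _root_.mul_apply_eq_comp] at h3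
    rw [evalHom_shiftPow_proj_basisVec hw, hm₀, if_pos rfl, ← hv,
      evalHom_shiftPow_proj_apply hw] at h3
    by_contra hne
    rw [if_neg fun h => hne (by rw [← h]; rfl)] at h3
    exact hm h3.symm
  obtain ⟨p, q, hpq⟩ := htail m
  -- The offset `q + 1` absorbs the index shift caused by `s`.
  obtain ⟨j, hj⟩ := hy p (q + 1)
  refine hj ?_
  rw [← hstep, show q + 1 + j = q + (j + 1) by omega, ← hpq]
  rfl

open scoped Topology

/-! ### Permutation automorphisms with prescribed action on the diagonal -/

/-- The automorphism acting on `φ^j(𝒟_n^1)` by `σ j` for `j < K` and by `τ` for `j ≥ K`. -/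
def truncAut {n : ℕ} (σ : ℕ → Equiv.Perm (Fin n)) (τ : Equiv.Perm (Fin n)) (K : ℕ) :
    O n ≃⋆ₐ[ℂ] O n :=
  (relabel τ).trans (letterAut (fun j => σ j * τ⁻¹) K)

theorem truncAut_apply {n : ℕ} (σ : ℕ → Equiv.Perm (Fin n)) (τ : Equiv.Perm (Fin n)) (K : ℕ)
    (x : O n) : truncAut σ τ K x = letterAut (fun j => σ j * τ⁻¹) K (relabel τ x) := rfl

theorem truncAut_shiftPow_proj {n : ℕ} {σ : ℕ → Equiv.Perm (Fin n)} {τ : Equiv.Perm (Fin n)}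
    {K : ℕ} (hσ : ∀ k ≥ K, σ k = τ) (j : ℕ) (i : Fin n) :
    truncAut σ τ K (shiftPow n j (proj i)) = shiftPow n j (proj (σ j i)) := by
  rw [truncAut_apply, relabel_shiftPow, relabel_proj]
  rcases lt_or_ge j K with hj | hj
  · rw [letterAut_shiftPow_proj_of_lt _ hj]
    simp
  · rw [letterAut_shiftPow_of_le _ hj, hσ j hj]

theorem isPermutationAut_truncAut {n : ℕ} {σ : ℕ → Equiv.Perm (Fin n)} {τ : Equiv.Perm (Fin n)}
    {K : ℕ} (hσ : ∀ k ≥ K, σ k = τ) : IsPermutationAut (truncAut σ τ K) := by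
  -- In `S_i S_μ` the letter `μ j` sits in position `j + 1`. Undoing `σ j` before applying `σ (j +
  -- 1)` gives `π (j + 1) = σ (j + 1) * (σ j)⁻¹`, with `π 0 = σ 0`.
  let π : ℕ → Equiv.Perm (Fin n) := fun j => σ j * (Nat.casesOn j 1 σ : Equiv.Perm (Fin n))⁻¹
  let a : ℕ → Equiv.Perm (Fin n) := fun j => σ j * τ⁻¹
  refine ⟨K + 1, letterPerm π (K + 1), fun i => eq_of_mul_word K fun μ => ?_⟩
  set ν : Fin (K + 1) → Fin n := Fin.cons (τ i) ((letterPerm a K)⁻¹ μ) with hν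
  have hkey : ∀ j : Fin (K + 1),
      letterPerm π (K + 1) (Fin.cons i μ : Fin (K + 1) → Fin n) j = a j (ν j) := by
    intro j
    induction j using Fin.cases with
    | zero => simp [π, a, hν]
    | succ j =>
      change (σ (j + 1) * (σ j)⁻¹) (μ j) = (σ (j + 1) * τ⁻¹) ((σ j * τ⁻¹)⁻¹ (μ j))
      simp
  have hcons : ∀ (l : Fin n) (μ' : Fin K → Fin n),
      S l * word μ' = word (Fin.cons l μ' : Fin (K + 1) → Fin n) := by
    intro l μ'
    rw [word_succ, Fin.cons_zero, Fin.tail_cons]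
  -- The unitary of level `K` leaves the last letter of a word of length `K + 1` alone, which agrees
  -- with `a K`.
  have hlast : a K = 1 := by simp [a, hσ K le_rfl]
  rw [truncAut_apply, relabel_S, letterAut_apply, mul_assoc, mul_assoc, permUnitary_mul_word,
    mul_assoc, hcons, hcons, permUnitary_mul_word, word_succ', word_succ', ← mul_assoc,
    permUnitary_mul_word, hkey]
  congr 2
  · funext j
    exact (hkey j.castSucc).symm
  · simp [hlast, hν, a]

/-! ### Product-type automorphisms given by sequences of permutations -/

theorem exists_eq_sum_smul_diagProj {n k : ℕ} {d : diag n} {x : O n} (hx : x ∈ diagLevel n 1)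
    (hd : (d : O n) = shiftPow n k x) :
    ∃ c : Fin n → ℂ, x = ∑ i, c i • proj i ∧ d = ∑ i, c i • diagProj k i := by
  obtain ⟨c, rfl⟩ := mem_diagLevel_one.1 hx
  refine ⟨c, rfl, Subtype.ext ?_⟩
  rw [hd, AddSubmonoidClass.coe_finsetSum, map_sum]
  exact Finset.sum_congr rfl fun i _ => map_smul _ _ _

theorem apply_sum_smul_diagProj {n k : ℕ} {α : diag n ≃⋆ₐ[ℂ] diag n} {σ : Equiv.Perm (Fin n)}
    (h : ∀ i, (α (diagProj k i) : O n) = shiftPow n k (proj (σ i))) (c : Fin n → ℂ) :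
    (α (∑ i, c i • diagProj k i) : O n) = shiftPow n k (∑ i, c i • proj (σ i)) := by
  rw [map_sum, AddSubmonoidClass.coe_finsetSum, map_sum]
  refine Finset.sum_congr rfl fun i _ => ?_
  rw [map_smul, map_smul, ← h]
  rfl

theorem relabel_mem_diagLevel_one {n : ℕ} (σ : Equiv.Perm (Fin n)) {x : O n}
    (hx : x ∈ diagLevel n 1) : relabel σ x ∈ diagLevel n 1 := by
  obtain ⟨c, rfl⟩ := mem_diagLevel_one.1 hx
  rw [map_sum]
  refine sum_mem fun i _ => ?_
  rw [map_smul, relabel_proj]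
  exact (diagLevel n 1).smul_mem (proj_mem_diagLevel_one _) _

/-- The automorphism of `𝒟_n^1` permuting its minimal projections. -/
def diagLevelRelabel {n : ℕ} (σ : Equiv.Perm (Fin n)) : diagLevel n 1 ≃⋆ₐ[ℂ] diagLevel n 1 :=
  StarAlgEquiv.ofStarAlgHom
    (((relabelHom σ).comp (diagLevel n 1).subtype).codRestrict (diagLevel n 1)
      fun x => relabel_mem_diagLevel_one σ x.2)
    (((relabelHom σ⁻¹).comp (diagLevel n 1).subtype).codRestrict (diagLevel n 1)
      fun x => relabel_mem_diagLevel_one σ⁻¹ x.2)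
    (StarAlgHom.ext fun x => Subtype.ext ((relabel σ).symm_apply_apply x))
    (StarAlgHom.ext fun x => Subtype.ext ((relabel σ).apply_symm_apply x))

theorem eventuallyIdentical_iff {n : ℕ} [Nontrivial (O n)] (hn : 0 < n)
    {α : diag n ≃⋆ₐ[ℂ] diag n} {σ : ℕ → Equiv.Perm (Fin n)}
    (hσ : ∀ k i, (α (diagProj k i) : O n) = shiftPow n k (proj (σ k i))) :
    EventuallyIdentical α ↔ ∃ K, ∀ k ≥ K, σ k = σ K := by
  constructor
  · rintro ⟨β, hβ⟩
    obtain ⟨K, hK⟩ := eventually_atTop.1 hβ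
    have h : ∀ k ≥ K, ∀ i, proj (σ k i) = (β ⟨proj i, proj_mem_diagLevel_one i⟩ : O n) :=
      fun k hk i => shiftPow_injective hn k <| by
        rw [← hσ]
        exact hK k hk ⟨proj i, proj_mem_diagLevel_one i⟩ (diagProj k i) rfl
    exact ⟨K, fun k hk => Equiv.ext fun i =>
      proj_injective ((h k hk i).trans (h K le_rfl i).symm)⟩
  · rintro ⟨K, hK⟩
    refine ⟨diagLevelRelabel (σ K), eventually_atTop.2 ⟨K, fun k hk x d hd => ?_⟩⟩
    obtain ⟨c, hx, rfl⟩ := exists_eq_sum_smul_diagProj x.2 hd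
    rw [apply_sum_smul_diagProj (hσ k), hK k hk]
    change _ = shiftPow n k (relabel (σ K) (x : O n))
    rw [hx]
    simp only [map_sum, map_smul, relabel_proj]

theorem exists_permutationAut {n : ℕ} {α : diag n ≃⋆ₐ[ℂ] diag n} {σ : ℕ → Equiv.Perm (Fin n)}
    (hσ : ∀ k i, (α (diagProj k i) : O n) = shiftPow n k (proj (σ k i)))
    (hev : ∃ K, ∀ k ≥ K, σ k = σ K) :
    ∃ θ : O n ≃⋆ₐ[ℂ] O n, IsPermutationAut θ ∧ ∀ d : diag n, θ (d : O n) = (α d : O n) := by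
  obtain ⟨K, hK⟩ := hev
  refine ⟨truncAut σ (σ K) K, isPermutationAut_truncAut hK, fun d => ?_⟩
  have h : ((truncAut σ (σ K) K : O n ≃⋆ₐ[ℂ] O n) : O n →⋆ₐ[ℂ] O n).comp (diag n).subtype
      = (diag n).subtype.comp (α : diag n →⋆ₐ[ℂ] diag n) :=
    diagHom_ext fun k i => (truncAut_shiftPow_proj hK k i).trans (hσ k i).symm
  exact DFunLike.congr_fun h d

theorem exists_eq_of_extends {n : ℕ} (hn : 2 ≤ n) {α : diag n ≃⋆ₐ[ℂ] diag n}
    {σ : ℕ → Equiv.Perm (Fin n)}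
    (hσ : ∀ k i, (α (diagProj k i) : O n) = shiftPow n k (proj (σ k i)))
    (hρ : ∃ ρ : O n →⋆ₐ[ℂ] O n, Extends ρ α) : ∃ K, ∀ k ≥ K, σ k = σ K := by
  obtain ⟨ρ, hρ⟩ := hρ
  obtain ⟨K, hK⟩ := eventually_atTop.1
    (eventually_eq_of_hom hn fun k i => (hρ (diagProj k i)).trans (hσ k i))
  refine ⟨K, fun k hk => ?_⟩
  induction k, hk using Nat.le_induction with
  | base => rfl
  | succ k hk ih => rw [hK k hk, ih]

/-! ### Automorphisms of the diagonal as limits of inner automorphisms -/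

/-- An `ε/3` argument: for contractions, the Cauchy property passes to limits of points of
convergence. -/
theorem isClosed_setOf_exists_tendsto {A : Type*} [NormedAddCommGroup A] [CompleteSpace A]
    {f : ℕ → A → A} (hf : ∀ k x y, dist (f k x) (f k y) ≤ dist x y) :
    IsClosed {x | ∃ y, Tendsto (fun k => f k x) atTop (𝓝 y)} := by
  refine isClosed_of_closure_subset fun x hx => cauchySeq_tendsto_of_complete ?_
  rw [Metric.cauchySeq_iff]
  intro ε hε
  obtain ⟨y, ⟨z, hz⟩, hxy⟩ := Metric.mem_closure_iff.1 hx (ε / 3) (by positivity)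
  obtain ⟨N, hN⟩ := Metric.cauchySeq_iff.1 hz.cauchySeq (ε / 3) (by positivity)
  refine ⟨N, fun k hk l hl => ?_⟩
  have h1 := dist_triangle4 (f k x) (f k y) (f l y) (f l x)
  have h2 := hf k x y
  have h3 := hf l y x
  have h4 := hN k hk l hl
  rw [dist_comm y x] at h3
  linarith

theorem letterAut_mem_diag {n : ℕ} (a : ℕ → Equiv.Perm (Fin n)) (k : ℕ) {x : O n}
    (hx : x ∈ diag n) : letterAut a k x ∈ diag n := by
  have hle : diag n ≤ (diag n).comap ((letterAut a k : O n ≃⋆ₐ[ℂ] O n) : O n →⋆ₐ[ℂ] O n) := by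
    refine diag_le_of_shiftPow_proj_mem ((isClosed_diag n).preimage
      (map_continuous ((letterAut a k : O n ≃⋆ₐ[ℂ] O n) : O n →⋆ₐ[ℂ] O n))) fun j i => ?_
    change letterAut a k (shiftPow n j (proj i)) ∈ diag n
    rcases lt_or_ge j k with hj | hj
    · rw [letterAut_shiftPow_proj_of_lt a hj]
      exact (diagProj j _).2
    · rw [letterAut_shiftPow_of_le a hj]
      exact (diagProj j i).2
  exact hle hx

/-- The elements at which the automorphisms `letterAut a k` converge as `k → ∞`. -/
def convSubalgebra {n : ℕ} (a : ℕ → Equiv.Perm (Fin n)) : StarSubalgebra ℂ (O n) where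
  carrier := {x | ∃ y, Tendsto (fun k => letterAut a k x) atTop (𝓝 y)}
  mul_mem' := by
    rintro x x' ⟨y, h⟩ ⟨y', h'⟩
    exact ⟨y * y', by simpa only [map_mul] using h.mul h'⟩
  add_mem' := by
    rintro x x' ⟨y, h⟩ ⟨y', h'⟩
    exact ⟨y + y', by simpa only [map_add] using h.add h'⟩
  algebraMap_mem' r := ⟨algebraMap ℂ (O n) r, by
    simpa only [AlgHomClass.commutes] using tendsto_const_nhds⟩
  star_mem' := by
    rintro x ⟨y, h⟩
    exact ⟨star y, by simpa only [map_star] using h.star⟩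

/-- On each generating projection `φ^j(S_i S_i^*)` the sequence is constant once `k > j`. -/
theorem diag_le_convSubalgebra {n : ℕ} (a : ℕ → Equiv.Perm (Fin n)) :
    diag n ≤ convSubalgebra a := by
  refine diag_le_of_shiftPow_proj_mem (isClosed_setOf_exists_tendsto fun k x y => ?_) fun j i =>
    ⟨shiftPow n j (proj (a j i)), tendsto_const_nhds.congr' ?_⟩
  · rw [dist_eq_norm, dist_eq_norm, ← map_sub]
    exact NonUnitalStarAlgHom.norm_apply_le
      ((letterAut a k : O n ≃⋆ₐ[ℂ] O n) : O n →⋆ₐ[ℂ] O n) (x - y)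
  · filter_upwards [eventually_gt_atTop j] with k hk
    exact (letterAut_shiftPow_proj_of_lt a hk i).symm

theorem exists_letterLimit {n : ℕ} (a : ℕ → Equiv.Perm (Fin n)) (d : diag n) :
    ∃ d' : diag n, Tendsto (fun k => letterAut a k (d : O n)) atTop (𝓝 (d' : O n)) := by
  obtain ⟨y, hy⟩ := diag_le_convSubalgebra a d.2
  exact ⟨⟨y, (isClosed_diag n).mem_of_tendsto hy
    (Eventually.of_forall fun k => letterAut_mem_diag a k d.2)⟩, hy⟩

/-- The limit of the automorphisms `letterAut a k` on the diagonal. -/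
def letterLimit {n : ℕ} (a : ℕ → Equiv.Perm (Fin n)) (d : diag n) : diag n :=
  (exists_letterLimit a d).choose

theorem tendsto_letterLimit {n : ℕ} (a : ℕ → Equiv.Perm (Fin n)) (d : diag n) :
    Tendsto (fun k => letterAut a k (d : O n)) atTop (𝓝 (letterLimit a d : O n)) :=
  (exists_letterLimit a d).choose_spec

theorem letterLimit_eq {n : ℕ} {a : ℕ → Equiv.Perm (Fin n)} {d d' : diag n}
    (h : Tendsto (fun k => letterAut a k (d : O n)) atTop (𝓝 (d' : O n))) :
    letterLimit a d = d' :=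
  Subtype.ext (tendsto_nhds_unique (tendsto_letterLimit a d) h)

/-- `letterLimit` as a `⋆`-homomorphism. -/
def letterLimitHom {n : ℕ} (a : ℕ → Equiv.Perm (Fin n)) : diag n →⋆ₐ[ℂ] diag n where
  toFun := letterLimit a
  map_one' := letterLimit_eq (by
    simpa only [OneMemClass.coe_one, map_one] using tendsto_const_nhds)
  map_mul' x y := letterLimit_eq (by
    simpa only [MulMemClass.coe_mul, map_mul] using
      (tendsto_letterLimit a x).mul (tendsto_letterLimit a y))
  map_zero' := letterLimit_eq (by
    simpa only [ZeroMemClass.coe_zero, map_zero] using tendsto_const_nhds)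
  map_add' x y := letterLimit_eq (by
    simpa only [AddMemClass.coe_add, map_add] using
      (tendsto_letterLimit a x).add (tendsto_letterLimit a y))
  commutes' r := letterLimit_eq (tendsto_const_nhds.congr fun k =>
    (AlgHomClass.commutes (letterAut a k) r).symm)
  map_star' x := letterLimit_eq (by
    simpa only [StarMemClass.coe_star, map_star] using (tendsto_letterLimit a x).star)

theorem letterLimitHom_diagProj {n : ℕ} (a : ℕ → Equiv.Perm (Fin n)) (j : ℕ) (i : Fin n) :
    letterLimitHom a (diagProj j i) = diagProj j (a j i) := by
  refine letterLimit_eq (tendsto_const_nhds.congr' ?_)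
  filter_upwards [eventually_gt_atTop j] with k hk
  exact (letterAut_shiftPow_proj_of_lt a hk i).symm

theorem letterLimitHom_comp {n : ℕ} {a b : ℕ → Equiv.Perm (Fin n)} (h : ∀ j, a j * b j = 1) :
    (letterLimitHom a).comp (letterLimitHom b) = StarAlgHom.id ℂ (diag n) := by
  have h1 : (diag n).subtype.comp ((letterLimitHom a).comp (letterLimitHom b))
      = (diag n).subtype := diagHom_ext fun j i => by
    rw [StarAlgHom.comp_apply, StarAlgHom.comp_apply, letterLimitHom_diagProj,
      letterLimitHom_diagProj, ← Equiv.Perm.mul_apply, h]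
    rfl
  exact StarAlgHom.ext fun d => Subtype.ext (DFunLike.congr_fun h1 d)

/-- The automorphism of the diagonal acting on `φ^j(𝒟_n^1)` by the permutation `a j`. -/
def productAut {n : ℕ} (a : ℕ → Equiv.Perm (Fin n)) : diag n ≃⋆ₐ[ℂ] diag n :=
  StarAlgEquiv.ofStarAlgHom (letterLimitHom a) (letterLimitHom fun j => (a j)⁻¹)
    (letterLimitHom_comp (by simp)) (letterLimitHom_comp (by simp))

theorem productAut_diagProj {n : ℕ} (a : ℕ → Equiv.Perm (Fin n)) (j : ℕ) (i : Fin n) :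
    (productAut a (diagProj j i) : O n) = shiftPow n j (proj (a j i)) :=
  congrArg Subtype.val (letterLimitHom_diagProj a j i)

theorem isProductType_productAut {n : ℕ} (a : ℕ → Equiv.Perm (Fin n)) :
    IsProductType (productAut a) := by
  intro k
  apply Set.Subset.antisymm
  · rintro _ ⟨d, ⟨x, hx, hd⟩, rfl⟩
    obtain ⟨c, -, rfl⟩ := exists_eq_sum_smul_diagProj hx hd.symm
    exact ⟨∑ i, c i • proj (a k i), sum_mem fun i _ =>
      (diagLevel n 1).smul_mem (proj_mem_diagLevel_one _) _,
      (apply_sum_smul_diagProj (productAut_diagProj a k) c).symm⟩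
  · rintro _ ⟨x, hx, rfl⟩
    obtain ⟨c, rfl⟩ := mem_diagLevel_one.1 hx
    -- Precomposing the coefficients with `a k` cancels the permutation after reindexing the sum.
    refine ⟨∑ i, c (a k i) • diagProj k i,
      ⟨∑ i, c (a k i) • proj i, mem_diagLevel_one.2 ⟨_, rfl⟩, ?_⟩, ?_⟩
    · rw [← shiftPow_apply, map_sum, AddSubmonoidClass.coe_finsetSum]
      exact Finset.sum_congr rfl fun i _ => map_smul _ _ _
    · refine (apply_sum_smul_diagProj (productAut_diagProj a k) _).trans ?_
      rw [Equiv.sum_comp (a k) fun i => c i • proj i]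
      rfl

theorem exists_isProductType_not_extends {n : ℕ} (hn : 2 ≤ n) :
    ∃ α : diag n ≃⋆ₐ[ℂ] diag n, IsProductType α ∧ ¬ ∃ ρ : O n →⋆ₐ[ℂ] O n, Extends ρ α := by
  have := Fin.nontrivial_iff_two_le.2 hn
  obtain ⟨b, c, hbc⟩ := exists_pair_ne (Fin n)
  let a : ℕ → Equiv.Perm (Fin n) := fun k => if Even k then 1 else Equiv.swap b c
  refine ⟨productAut a, isProductType_productAut a, fun hρ => ?_⟩
  obtain ⟨K, hK⟩ := exists_eq_of_extends hn (productAut_diagProj a) hρ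
  have h : a (2 * K) = a (2 * K + 1) := (hK _ (by omega)).trans (hK _ (by omega)).symm
  have h1 := DFunLike.congr_fun h b
  simp [a, hbc] at h1

end Cuntz

end

theorem proposition3p1 (n : ℕ) (hn : 2 ≤ n) :
    (∀ α : Cuntz.diag n ≃⋆ₐ[ℂ] Cuntz.diag n, Cuntz.IsProductType α →
      ((∃ ρ : Cuntz.O n →⋆ₐ[ℂ] Cuntz.O n, Cuntz.Extends ρ α) ↔ Cuntz.EventuallyIdentical α) ∧
      ((∃ ρ : Cuntz.O n →⋆ₐ[ℂ] Cuntz.O n, Cuntz.Extends ρ α) →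
        ∃ θ : Cuntz.O n ≃⋆ₐ[ℂ] Cuntz.O n, Cuntz.IsPermutationAut θ ∧
          ∀ d : Cuntz.diag n, θ (d : Cuntz.O n) = (α d : Cuntz.O n))) ∧
    (∃ α : Cuntz.diag n ≃⋆ₐ[ℂ] Cuntz.diag n, Cuntz.IsProductType α ∧
      ¬ ∃ ρ : Cuntz.O n →⋆ₐ[ℂ] Cuntz.O n, Cuntz.Extends ρ α) := by
  refine ⟨fun α hα => ?_, Cuntz.exists_isProductType_not_extends hn⟩
  have := Cuntz.nontrivial_O hn
  obtain ⟨σ, hσ⟩ := hα.exists_perm (by omega)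
  have hiff := Cuntz.eventuallyIdentical_iff (by omega) hσ
  have hfwd := Cuntz.exists_eq_of_extends hn hσ
  refine ⟨⟨fun h => hiff.2 (hfwd h), fun h => ?_⟩,
    fun h => Cuntz.exists_permutationAut hσ (hfwd h)⟩
  obtain ⟨θ, -, hθ⟩ := Cuntz.exists_permutationAut hσ (hiff.1 h)
  exact ⟨(θ : Cuntz.O n →⋆ₐ[ℂ] Cuntz.O n), hθ⟩
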